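/- **Setting.** Let $G$ and $H$ be finitely generated groups with finite generating sets $S_G$ and $S_H$, and let $\mathcal U$ be a non-principal ultrafilter on $\mathbb N$. The Cayley graph of $(G,S_G)$ has vertex set $G$ and, for all $g\in G$ and $s\in S_G$, an edge labelled $s$ from $g$ to $gs$. Graphs carry the graph metric, with orientations ignored and with infinite distance between different components; $B(x,r)$ is the closed $r$-ball around $x$; $H$ carries the word metric given by the Cayley graph of $(H,S_H)$; $\mathbb P_F$ is the uniform probability on a finite set $F$. A sequence $(\mathcal G_n)_{n\in\mathbb N}$ of finite directed graphs with edges labelled by $S_G$ is a *sofic approximation* of $(G,S_G)$ if, for every $r\ge 0$, $$\lim_{n\to\infty}\mathbb P_{\mathcal G_n}\bigl(\{x : B_{\mathcal G_n}(x,r)\cong B_G(e_G,r)\}\bigr)=1,$$ where $\cong$ means isomorphism of directed labelled graphs (induced on the balls) that sends $x$ to $e_G$. A sequence of maps $\mathfrak u_n:\mathcal G_n\to H$ is *$\mathcal U$-statistically Lipschitz* if, for every $r\ge 0$, $$\lim_{C\to\infty}\lim_{\mathcal U}\mathbb P_{\mathcal G_n}\bigl(\{y : \operatorname{diam}\mathfrak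 u_n(B_{\mathcal G_n}(y,r))\ge C\}\bigr)=0 .$$ A *measure subgroup coupling* from $G$ to $H$ is a standard Borel space $\Omega$ with a $\sigma$-finite measure $\mu$ and commuting, free, measure-preserving Borel actions of $G$ and $H$ that admit measure fundamental domains $X_G$ and $X_H$, with $\mu(X_H)=1$. (A measure fundamental domain for an action of a group $K$ is a Borel set $X$ such that $\mu(kX\cap X)=0$ for all $k\ne e$ and $\mu(\Omega\setminus KX)=0$.) Its cocycle $\alpha:G\times X_H\to H$ is defined, for almost every $x\in X_H$ and all $g\in G$, by letting $\alpha(g,x)$ be the unique $h\in H$ with $h*(g*x)\in X_H$. The coupling is *injective* if $\alpha(\cdot,x):G\to H$ is injective for almost every $x\in X_H$. **Theorem 1.4.** Let $(\mathcal G_n)_n$ be a sofic approximation of $(G,S_G)$ and let $\mathfrak u_n:\mathcal G_n\to H$ be a sequence of injective maps that is $\mathcal U$-statistically Lipschitz. Then there exists an injective measure subgroup coupling $(\Omega,\mu)$ from $G$ to $H$. -/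

import Mathlib

open Filter Topology MeasureTheory

universe u v w

/-- A directed graph on `V` whose edges carry labels in `L`: `Γ.Edge s x y` says that there is an
edge labelled `s` from `x` to `y`. -/
structure LabeledDigraph (L : Type u) (V : Type v) where
  Edge : L → V → V → Prop

namespace LabeledDigraph

variable {L : Type*} {V : Type*} {W : Type*}

/-- The undirected graph obtained by forgetting labels and orientations. -/
def toSimpleGraph (Γ : LabeledDigraph L V) : SimpleGraph V :=
  SimpleGraph.fromRel (fun x y => ∃ s, Γ.Edge s x y)

/-- The graph distance (orientations are ignored; it is `⊤` between different components). -/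
noncomputable def dist (Γ : LabeledDigraph L V) (x y : V) : ℕ∞ :=
  Γ.toSimpleGraph.edist x y

/-- The closed ball of radius `r` around `x`. -/
def ball (Γ : LabeledDigraph L V) (x : V) (r : ℕ) : Set V :=
  {y | Γ.dist x y ≤ (r : ℕ∞)}

/-- The diameter of a set of vertices. -/
noncomputable def diam (Γ : LabeledDigraph L V) (A : Set V) : ℕ∞ :=
  ⨆ x ∈ A, ⨆ y ∈ A, Γ.dist x y

/-- The `r`-balls around `x` and `y` (as induced subgraphs) are isomorphic as directed labelled
graphs, by an isomorphism that sends the centre `x` to the centre `y`. -/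
def BallIso (Γ : LabeledDigraph L V) (Δ : LabeledDigraph L W) (r : ℕ) (x : V) (y : W) : Prop :=
  ∃ θ : Γ.ball x r ≃ Δ.ball y r,
    (∀ a : Γ.ball x r, (a : V) = x → (θ a : W) = y) ∧
    ∀ (s : L) (a b : Γ.ball x r), Γ.Edge s a b ↔ Δ.Edge s (θ a) (θ b)

end LabeledDigraph

/-- The Cayley graph of `(G, S)`: for each `g` and each `s ∈ S` an edge labelled `s` from `g`
to `g * s`. Its graph distance is the left-invariant word metric. -/
def cayleyGraph {G : Type*} [Group G] (S : Finset G) : LabeledDigraph S G where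
  Edge s g h := h = g * (s : G)

/-- The uniform probability of a subset of a finite set (`0` if the finite set is empty). -/
noncomputable def uniformProb {V : Type*} (A : Set V) : ℝ :=
  (A.ncard : ℝ) / (Nat.card V : ℝ)

/-- The sequence of `S`-labelled directed graphs `Γ n` (on finite vertex sets) is a sofic
approximation of `(G, S)`: for each `r`, the proportion of vertices whose `r`-ball is isomorphic
to the `r`-ball of the Cayley graph around the identity tends to one. -/
def IsSoficApproximation {G : Type*} [Group G] (S : Finset G) {V : ℕ → Type*}
    (Γ : ∀ n, LabeledDigraph S (V n)) : Prop :=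
  ∀ r : ℕ, Tendsto
    (fun n => uniformProb {x : V n | (Γ n).BallIso (cayleyGraph S) r x (1 : G)}) atTop (𝓝 1)

/-- `𝒰`-statistically Lipschitz sequences of maps `f n` from (the vertex sets of) finite graphs
`Γ n` to a graph `Δ`: for all `r`,
`lim_{C → ∞} lim_{n → 𝒰} ℙ {y | diam (f n (B(y, r))) ≥ C} = 0`.
Here `ℓ C` is the inner limit, which always exists since `𝒰` is an ultrafilter. -/
def StatisticallyLipschitz (𝒰 : Ultrafilter ℕ) {L M : Type*} {V : ℕ → Type*} {W : Type*}
    (Γ : ∀ n, LabeledDigraph L (V n)) (Δ : LabeledDigraph M W) (f : ∀ n, V n → W) : Prop :=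
  ∀ r : ℕ, ∃ ℓ : ℕ → ℝ,
    (∀ C : ℕ, Tendsto
      (fun n => uniformProb {y : V n | (C : ℕ∞) ≤ Δ.diam (f n '' (Γ n).ball y r)})
      (𝒰 : Filter ℕ) (𝓝 (ℓ C))) ∧
    Tendsto ℓ atTop (𝓝 0)

/-- A measure subgroup coupling from `G` to `H`: a standard Borel space `Ω` with a `σ`-finite
measure `μ` and commuting, free, measure preserving actions of `G` and `H`, together with
(Borel, almost everywhere) fundamental domains `XG` of `G` and `XH` of `H`, where `XH` has
measure one. -/
structure MeasureSubgroupCoupling (G : Type u) (H : Type v) [Group G] [Group H] where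
  Ω : Type (max u v)
  [measurableSpace : MeasurableSpace Ω]
  [standardBorel : StandardBorelSpace Ω]
  μ : Measure Ω
  [sigmaFinite : SigmaFinite μ]
  [actG : MulAction G Ω]
  [actH : MulAction H Ω]
  [commute : SMulCommClass G H Ω]
  measurePreservingG : ∀ g : G, MeasurePreserving (fun ω : Ω => g • ω) μ μ
  measurePreservingH : ∀ h : H, MeasurePreserving (fun ω : Ω => h • ω) μ μ
  freeG : ∀ (g : G) (ω : Ω), g • ω = ω → g = 1
  freeH : ∀ (h : H) (ω : Ω), h • ω = ω → h = 1
  XG : Set Ω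
  XH : Set Ω
  measurableSet_XG : MeasurableSet XG
  measurableSet_XH : MeasurableSet XH
  fundamentalDomainG : IsFundamentalDomain G XG μ
  fundamentalDomainH : IsFundamentalDomain H XH μ
  measure_XH : μ XH = 1

namespace MeasureSubgroupCoupling

variable {G : Type u} {H : Type v} [Group G] [Group H]

attribute [instance] measurableSpace standardBorel sigmaFinite actG actH commute

/-- `α : G × XH → H` is the cocycle of the coupling: it is Borel and, for almost every `x ∈ XH`
and all `g`, the element `α g x` is the unique `h ∈ H` that maps `g • x` back to `XH`. (The values
of `α` outside `XH` are irrelevant.) -/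
def IsCocycle (c : MeasureSubgroupCoupling G H) (α : G → c.Ω → H) : Prop :=
  (∀ (g : G) (h : H), MeasurableSet {x : c.Ω | α g x = h}) ∧
  ∀ᵐ x ∂(c.μ.restrict c.XH), ∀ (g : G) (h : H), h • g • x ∈ c.XH ↔ h = α g x

/-- The coupling is injective: for almost every `x ∈ XH`, the map `α(·, x) : G → H` given by its
cocycle is injective. -/
def IsInjective (c : MeasureSubgroupCoupling G H) : Prop :=
  ∃ α : G → c.Ω → H, c.IsCocycle α ∧
    ∀ᵐ x ∂(c.μ.restrict c.XH), Function.Injective (fun g => α g x)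

end MeasureSubgroupCoupling

/-! Pick a vertex `y` of `𝒢 n` uniformly at random and look at the image of `𝔲 n` from `y`: this is
the random map `g ↦ (𝔲 y)⁻¹ * 𝔲 (y · g)` from `G` to `H`, where `y · g` is the end of a path from
`y` that spells `g`. The statistical Lipschitz condition makes each coordinate tight, so the laws
have a limit `ν` on `G → H` (`exists_limit_law`). Since `y ↦ y · g` is injective off a small set, it
almost preserves the uniform measure, and `ν` is invariant under `φ ↦ (φ g)⁻¹ * φ (g * ·)`. Since `𝔲
n` is injective and the approximate action is almost free, `ν` lives on injective maps
(`exists_injective_coupling_of_approximate_actions`).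

The coupling space is the set of injective maps, with `G` translating the variable, `H` translating
the values, and the sum of the `H`-translates of `ν` as measure. Invariance of `ν` up to
renormalization is exactly `G`-invariance of this sum. The maps with `ψ 1 = 1` form a domain for
`H`; injectivity gives a domain for `G`, and the cocycle `(ψ g⁻¹)⁻¹` is injective in `g`.

Tightness is known only along `𝒰`. As it amounts to countably many conditions, a diagonal sequence
of indices satisfies each of them eventually. -/

/-! ### Words in a finite subset of a group -/

/-- The element of `G` spelled by a word in `S` and the inverses of its elements; words are read
from right to left, so that the head of the list is the last letter. -/
def wordEval {G : Type*} [Group G] (S : Finset G) : List (S × Bool) → G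
  | [] => 1
  | a :: w => wordEval S w * (if a.2 then (a.1 : G) else (a.1 : G)⁻¹)

theorem wordEval_append {G : Type*} [Group G] (S : Finset G) (w₁ w₂ : List (S × Bool)) :
    wordEval S (w₂ ++ w₁) = wordEval S w₁ * wordEval S w₂ := by
  induction w₂ with
  | nil => simp [wordEval]
  | cons a w ih => simp [wordEval, ih, mul_assoc]

theorem wordEval_surjective {G : Type*} [Group G] {S : Finset G}
    (hS : Subgroup.closure (S : Set G) = ⊤) : Function.Surjective (wordEval S) := by
  intro g
  have hg : g ∈ Subgroup.closure (S : Set G) := hS ▸ Subgroup.mem_top g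
  induction hg using Subgroup.closure_induction_right with
  | one => exact ⟨[], rfl⟩
  | mul_right x _ y hy ih =>
    obtain ⟨w, hw⟩ := ih
    exact ⟨(⟨y, hy⟩, true) :: w, by simp [wordEval, hw]⟩
  | mul_inv_cancel x _ y hy ih =>
    obtain ⟨w, hw⟩ := ih
    exact ⟨(⟨y, hy⟩, false) :: w, by simp [wordEval, hw]⟩

theorem countable_of_closure_eq_top {G : Type*} [Group G] {S : Finset G}
    (hS : Subgroup.closure (S : Set G) = ⊤) : Countable G :=
  (wordEval_surjective hS).countable

/-! ### Paths that read a word -/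

namespace LabeledDigraph

variable {L : Type*} {V : Type*}

/-- `Γ.Step (s, b) x y`: an edge labelled `s` leads from `x` to `y`, traversed forwards if `b` is
true and backwards otherwise. -/
def Step (Γ : LabeledDigraph L V) (a : L × Bool) (x y : V) : Prop :=
  if a.2 then Γ.Edge a.1 x y else Γ.Edge a.1 y x

/-- `Γ.Reach w x y`: some path from `x` to `y` reads the word `w` (from right to left). -/
def Reach (Γ : LabeledDigraph L V) : List (L × Bool) → V → V → Prop
  | [], x, y => y = x
  | a :: w, x, y => ∃ m, Γ.Reach w x m ∧ Γ.Step a m y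

theorem reach_append {Γ : LabeledDigraph L V} {w₁ w₂ : List (L × Bool)} {x z : V} :
    Γ.Reach (w₂ ++ w₁) x z ↔ ∃ m, Γ.Reach w₁ x m ∧ Γ.Reach w₂ m z := by
  induction w₂ generalizing z with
  | nil => simp [Reach]
  | cons a w ih =>
    simp only [List.cons_append, Reach, ih]
    constructor
    · rintro ⟨m, ⟨m', h₁, h₂⟩, h₃⟩
      exact ⟨m', h₁, m, h₂, h₃⟩
    · rintro ⟨m', h₁, m, h₂, h₃⟩
      exact ⟨m, ⟨m', h₁, h₂⟩, h₃⟩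

theorem Step.dist_le_one {Γ : LabeledDigraph L V} {a : L × Bool} {x y : V} (h : Γ.Step a x y) :
    Γ.dist x y ≤ 1 := by
  by_cases hxy : x = y
  · simp [dist, hxy]
  · refine le_of_eq ((SimpleGraph.edist_eq_one_iff_adj).2 ?_)
    simp only [toSimpleGraph, SimpleGraph.fromRel_adj]
    refine ⟨hxy, ?_⟩
    unfold Step at h
    split_ifs at h
    exacts [Or.inl ⟨_, h⟩, Or.inr ⟨_, h⟩]

theorem Reach.dist_le {Γ : LabeledDigraph L V} {w : List (L × Bool)} {x y : V}
    (h : Γ.Reach w x y) : Γ.dist x y ≤ (w.length : ℕ∞) := by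
  induction w generalizing y with
  | nil => simp only [Reach] at h; simp [dist, h]
  | cons a w ih =>
    obtain ⟨m, h₁, h₂⟩ := h
    calc Γ.dist x y ≤ Γ.dist x m + Γ.dist m y := SimpleGraph.edist_triangle
      _ ≤ w.length + 1 := add_le_add (ih h₁) h₂.dist_le_one
      _ = _ := by simp

theorem Reach.mem_ball {Γ : LabeledDigraph L V} {w : List (L × Bool)} {x y : V} {r : ℕ}
    (h : Γ.Reach w x y) (hr : w.length ≤ r) : y ∈ Γ.ball x r :=
  h.dist_le.trans (by exact_mod_cast hr)

theorem mem_ball_self (Γ : LabeledDigraph L V) (x : V) (r : ℕ) : x ∈ Γ.ball x r := by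
  simp [ball, dist]

/-- The endpoint of some path from `x` that reads `w`, and `x` itself if there is none. -/
noncomputable def endpoint (Γ : LabeledDigraph L V) (w : List (L × Bool)) (x : V) : V :=
  open Classical in if h : ∃ y, Γ.Reach w x y then h.choose else x

theorem Reach.endpoint {Γ : LabeledDigraph L V} {w : List (L × Bool)} {x y : V}
    (h : Γ.Reach w x y) : Γ.Reach w x (Γ.endpoint w x) := by
  have h' : ∃ y, Γ.Reach w x y := ⟨y, h⟩
  rw [LabeledDigraph.endpoint, dif_pos h']
  exact h'.choose_spec

end LabeledDigraph

/-! ### Balls modelled on the Cayley graph and approximate right translations -/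

section Cayley

open LabeledDigraph

variable {G : Type*} [Group G] {S : Finset G}

theorem cayleyGraph_step_iff {a : S × Bool} {x y : G} :
    (cayleyGraph S).Step a x y ↔ y = x * (if a.2 then (a.1 : G) else (a.1 : G)⁻¹) := by
  unfold Step cayleyGraph
  split_ifs
  · rfl
  · simp [eq_mul_inv_iff_mul_eq, eq_comm]

theorem cayleyGraph_reach_iff {w : List (S × Bool)} {x y : G} :
    (cayleyGraph S).Reach w x y ↔ y = x * wordEval S w := by
  induction w generalizing y with
  | nil => simp [Reach, wordEval]
  | cons a w ih => simp [Reach, wordEval, ih, cayleyGraph_step_iff, mul_assoc]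

theorem exists_word_of_walk {x y : G} (p : (cayleyGraph S).toSimpleGraph.Walk x y) :
    ∃ w : List (S × Bool), w.length = p.length ∧ y = x * wordEval S w := by
  induction p with
  | nil => exact ⟨[], rfl, by simp [wordEval]⟩
  | @cons x z y h p ih =>
    obtain ⟨w, hw, rfl⟩ := ih
    simp only [toSimpleGraph, SimpleGraph.fromRel_adj, cayleyGraph] at h
    obtain ⟨-, ⟨s, hs⟩ | ⟨s, hs⟩⟩ := h
    -- Words are read from the right, so the first edge of the walk goes to the end of the list; an
    -- edge crossed backwards contributes an inverse letter.
    · exact ⟨w ++ [(s, true)], by simp [hw], by simp [wordEval_append, wordEval, hs, mul_assoc]⟩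
    · exact ⟨w ++ [(s, false)], by simp [hw], by simp [wordEval_append, wordEval, hs, mul_assoc]⟩

variable (S) in
/-- Only finitely many group elements have word length at most `C`. -/
theorem finite_inv_mul_of_dist_le (C : ℕ) :
    {h : G | ∃ x y : G, (cayleyGraph S).dist x y ≤ (C : ℕ∞) ∧ h = x⁻¹ * y}.Finite := by
  refine ((List.finite_length_le (S × Bool) C).image (wordEval S)).subset ?_
  rintro _ ⟨x, y, hxy, rfl⟩
  have hne : (cayleyGraph S).toSimpleGraph.edist x y ≠ ⊤ :=
    ne_top_of_le_ne_top (ENat.natCast_ne_top C) hxy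
  obtain ⟨p, hp⟩ := SimpleGraph.exists_walk_of_edist_ne_top hne
  obtain ⟨w, hw, rfl⟩ := exists_word_of_walk p
  refine ⟨w, ?_, by simp⟩
  have : (p.length : ℕ∞) ≤ C := hp.trans_le hxy
  simpa [hw] using this

/-- If the ball around `x` is isomorphic to the one in the Cayley graph, the paths from `x` that
read a short word `w` end exactly at the point corresponding to the group element `w`. -/
theorem reach_iff_of_ballIso {V : Type*} {Γ : LabeledDigraph S V} {r : ℕ} {x : V}
    (θ : Γ.ball x r ≃ (cayleyGraph S).ball (1 : G) r)
    (h₁ : ∀ a : Γ.ball x r, (a : V) = x → (θ a : G) = 1)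
    (h₂ : ∀ (s : S) (a b : Γ.ball x r), Γ.Edge s a b ↔ (cayleyGraph S).Edge s (θ a : G) (θ b))
    {w : List (S × Bool)} (hw : w.length ≤ r) (z : Γ.ball x r) :
    Γ.Reach w x z ↔ (θ z : G) = wordEval S w := by
  have hstep (a : S × Bool) (p q : Γ.ball x r) :
      Γ.Step a p q ↔ (cayleyGraph S).Step a (θ p : G) (θ q) := by
    unfold Step
    split_ifs
    exacts [h₂ _ _ _, h₂ _ _ _]
  induction w generalizing z with
  | nil =>
    have h := h₁ ⟨x, Γ.mem_ball_self x r⟩ rfl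
    simp only [Reach, wordEval]
    exact ⟨fun e => h₁ z e,
      fun e => congrArg Subtype.val (θ.injective (Subtype.ext (e.trans h.symm)))⟩
  | cons a w ih =>
    have hw' : w.length ≤ r := by simp at hw; omega
    constructor
    · rintro ⟨m, hm, hs⟩
      have := (ih hw' ⟨m, hm.mem_ball hw'⟩).1 hm
      have hs' := (hstep a ⟨m, hm.mem_ball hw'⟩ z).1 hs
      rw [cayleyGraph_step_iff, this] at hs'
      exact hs'
    · intro hz
      -- The penultimate point of the path is found in the Cayley ball and pulled back by `θ`.
      have hmem : wordEval S w ∈ (cayleyGraph S).ball (1 : G) r :=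
        Reach.mem_ball (w := w) (cayleyGraph_reach_iff.2 (by simp)) hw'
      refine ⟨θ.symm ⟨_, hmem⟩, (ih hw' _).2 (by simp), (hstep _ _ _).2 ?_⟩
      rw [cayleyGraph_step_iff, hz]
      simp [wordEval]

variable {V : Type*} {Γ : LabeledDigraph S V} {r : ℕ} {x : V}

theorem LabeledDigraph.BallIso.reach_endpoint (h : Γ.BallIso (cayleyGraph S) r x (1 : G))
    {w : List (S × Bool)} (hw : w.length ≤ r) : Γ.Reach w x (Γ.endpoint w x) := by
  obtain ⟨θ, h₁, h₂⟩ := h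
  have hmem : wordEval S w ∈ (cayleyGraph S).ball (1 : G) r :=
    Reach.mem_ball (w := w) (cayleyGraph_reach_iff.2 (by simp)) hw
  exact ((reach_iff_of_ballIso θ h₁ h₂ hw (θ.symm ⟨_, hmem⟩)).2 (by simp)).endpoint

/-- The isomorphism sends each endpoint to the group element spelled by its word. Hence in a good
ball neither the word chosen for a group element nor the path chosen for the word matters. -/
theorem LabeledDigraph.BallIso.eq_iff (h : Γ.BallIso (cayleyGraph S) r x (1 : G))
    {w w' : List (S × Bool)} (hw : w.length ≤ r) (hw' : w'.length ≤ r) {z z' : V}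
    (hz : Γ.Reach w x z) (hz' : Γ.Reach w' x z') :
    z = z' ↔ wordEval S w = wordEval S w' := by
  obtain ⟨θ, h₁, h₂⟩ := h
  have e := (reach_iff_of_ballIso θ h₁ h₂ hw ⟨z, hz.mem_ball hw⟩).1 hz
  have e' := (reach_iff_of_ballIso θ h₁ h₂ hw' ⟨z', hz'.mem_ball hw'⟩).1 hz'
  rw [← e, ← e', Subtype.coe_inj, θ.injective.eq_iff, Subtype.mk.injEq]

/-- The approximate right translation by `g` on the vertices of an `S`-labelled graph. -/
noncomputable def LabeledDigraph.translate (hS : Subgroup.closure (S : Set G) = ⊤) (Γ : LabeledDigraph S V)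
    (g : G) : V → V :=
  Γ.endpoint (wordEval_surjective hS g).choose

/-- The length of the word through which `translate` moves by `g`. -/
noncomputable def translateLength (hS : Subgroup.closure (S : Set G) = ⊤) (g : G) : ℕ :=
  (wordEval_surjective hS g).choose.length

variable (hS : Subgroup.closure (S : Set G) = ⊤)

theorem LabeledDigraph.BallIso.translate_mem_ball {g : G} (h : Γ.BallIso (cayleyGraph S) r x (1 : G))
    (hr : translateLength hS g ≤ r) : Γ.translate hS g x ∈ Γ.ball x r :=
  (h.reach_endpoint hr).mem_ball hr

theorem LabeledDigraph.BallIso.translate_one (h : Γ.BallIso (cayleyGraph S) r x (1 : G))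
    (hr : translateLength hS 1 ≤ r) : Γ.translate hS 1 x = x :=
  (h.eq_iff (w' := []) hr (by simp) (h.reach_endpoint hr) rfl).2
    (wordEval_surjective hS 1).choose_spec

theorem LabeledDigraph.BallIso.translate_ne (h : Γ.BallIso (cayleyGraph S) r x (1 : G)) {g k : G}
    (hg : translateLength hS g ≤ r) (hk : translateLength hS k ≤ r) (hgk : g ≠ k) :
    Γ.translate hS g x ≠ Γ.translate hS k x := by
  rw [Ne, LabeledDigraph.translate, LabeledDigraph.translate, h.eq_iff hg hk (h.reach_endpoint hg) (h.reach_endpoint hk),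
    (wordEval_surjective hS g).choose_spec, (wordEval_surjective hS k).choose_spec]
  exact hgk

/-- Only the ball around `x` has to be good: a path for `k` from the translate of `x` by `g` is the
second half of a path from `x`, to which `eq_iff` applies. -/
theorem LabeledDigraph.BallIso.translate_mul (h : Γ.BallIso (cayleyGraph S) r x (1 : G)) {g k : G}
    (hgk : translateLength hS (g * k) ≤ r)
    (hr : translateLength hS g + translateLength hS k ≤ r) :
    Γ.translate hS (g * k) x = Γ.translate hS k (Γ.translate hS g x) := by
  set wg := (wordEval_surjective hS g).choose with hwg
  set wk := (wordEval_surjective hS k).choose with hwk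
  have eg : wordEval S wg = g := (wordEval_surjective hS g).choose_spec
  have ek : wordEval S wk = k := (wordEval_surjective hS k).choose_spec
  have hr' : (wk ++ wg).length ≤ r := by
    rw [List.length_append, add_comm]; exact hr
  have hg : wg.length ≤ r := (Nat.le_add_right _ _).trans hr
  obtain ⟨m, hm, hm'⟩ := reach_append.1 (h.reach_endpoint hr')
  have hmg : m = Γ.translate hS g x := (h.eq_iff hg hg hm (h.reach_endpoint hg)).2 rfl
  subst hmg
  refine (h.eq_iff hgk hr' (h.reach_endpoint hgk) (reach_append.2 ⟨_, hm, hm'.endpoint⟩)).2 ?_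
  rw [wordEval_append, eg, ek]
  exact (wordEval_surjective hS (g * k)).choose_spec

end Cayley

/-! ### Limits of empirical measures on a countable product of countable discrete spaces -/

section Limit

open ProbabilityTheory

theorem uniformProb_nonneg {V : Type*} (A : Set V) : 0 ≤ uniformProb A := by
  unfold uniformProb; positivity

theorem uniformProb_mono {V : Type*} [Finite V] {A B : Set V} (h : A ⊆ B) :
    uniformProb A ≤ uniformProb B := by
  unfold uniformProb
  gcongr
  exact Set.toFinite B

theorem uniformProb_union_le {V : Type*} (A B : Set V) :
    uniformProb (A ∪ B) ≤ uniformProb A + uniformProb B := by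
  unfold uniformProb
  rw [← add_div]
  gcongr
  exact_mod_cast Set.ncard_union_le A B

theorem uniformProb_compl {V : Type*} [Finite V] [Nonempty V] (A : Set V) :
    uniformProb Aᶜ = 1 - uniformProb A := by
  have h : (Nat.card V : ℝ) ≠ 0 := by exact_mod_cast Nat.card_pos.ne'
  unfold uniformProb
  rw [eq_sub_iff_add_eq, ← add_div, div_eq_one_iff_eq h, add_comm]
  exact_mod_cast Set.ncard_add_ncard_compl A

/-- Taking preimages under a map that is almost injective hardly increases the probability. -/
theorem uniformProb_inter_preimage_le {V : Type*} [Finite V] {T : V → V} {s : Set V}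
    (hT : Set.InjOn T s) (A : Set V) : uniformProb (s ∩ T ⁻¹' A) ≤ uniformProb A := by
  refine div_le_div_of_nonneg_right (Nat.cast_le.2 ?_) (Nat.cast_nonneg _)
  exact Set.ncard_le_ncard_of_injOn T (fun x hx => hx.2) (hT.mono Set.inter_subset_left)
    A.toFinite

theorem uniformOn_univ_real {V : Type*} [Finite V] [MeasurableSpace V]
    [DiscreteMeasurableSpace V] (A : Set V) :
    (uniformOn (Set.univ : Set V)).real A = uniformProb A := by
  have := Fintype.ofFinite V
  rw [Measure.real, uniformOn_univ, Measure.count_apply_finite A A.toFinite, uniformProb,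
    Set.ncard_eq_toFinset_card A, ENNReal.toReal_div]
  simp

/-- Finitely many exceptional terms of a tight sequence can be absorbed into the finite set. -/
theorem exists_finite_forall_uniformProb_le {H : Type*} {W : ℕ → Type*} [∀ m, Finite (W m)]
    (φ : ∀ m, W m → H) {ε : ℝ} (hε : 0 ≤ ε)
    (h : ∃ F : Set H, F.Finite ∧ ∀ᶠ m in atTop, uniformProb {y | φ m y ∉ F} ≤ ε) :
    ∃ F : Set H, F.Finite ∧ ∀ m, uniformProb {y | φ m y ∉ F} ≤ ε := by
  obtain ⟨F, hF, hev⟩ := h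
  obtain ⟨N, hN⟩ := eventually_atTop.1 hev
  -- The terms before `N` take only finitely many values in total.
  have hfin : (⋃ m : Fin N, Set.range (φ m)).Finite :=
    Set.finite_iUnion fun m => Set.finite_range _
  have hall (m : ℕ) : uniformProb {y | φ m y ∉ F ∪ ⋃ m : Fin N, Set.range (φ m)} ≤ ε := by
    rcases le_or_gt N m with hm | hm
    · exact (uniformProb_mono (fun y (hy : ¬ _) h => hy (Or.inl h))).trans (hN m hm)
    · have : {y | φ m y ∉ F ∪ ⋃ m : Fin N, Set.range (φ m)} = ∅ := by
        refine Set.eq_empty_of_forall_notMem fun y hy => hy (Or.inr ?_)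
        exact Set.mem_iUnion.2 ⟨⟨m, hm⟩, y, rfl⟩
      rw [this]
      simpa [uniformProb] using hε
  exact ⟨_, hF.union hfin, hall⟩

/-- A sequence of finite families of functions `I → H` whose one-dimensional marginals are tight
has a limit law along some ultrafilter. -/
theorem exists_limit_law {I : Type*} {H : Type*} [Countable I] [Countable H]
    [MeasurableSpace H] [DiscreteMeasurableSpace H] {W : ℕ → Type*} [∀ m, Finite (W m)]
    [∀ m, Nonempty (W m)] (φ : ∀ m, W m → I → H)
    (htight : ∀ (i : I) (ε : ℝ), 0 < ε → ∃ F : Set H, F.Finite ∧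
      ∀ᶠ m in atTop, uniformProb {y | φ m y i ∉ F} ≤ ε) :
    ∃ (f : Ultrafilter ℕ) (ν : Measure (I → H)), (f : Filter ℕ) ≤ atTop ∧ IsProbabilityMeasure ν ∧
      ∀ (s : Finset I) (A : Set (s → H)), Tendsto (fun m => uniformProb (φ m ⁻¹' cylinder (α := fun _ => H) s A)) f
        (𝓝 (ν.real (cylinder (α := fun _ => H) s A))) := by
  let : TopologicalSpace H := ⊥
  have : DiscreteTopology H := ⟨rfl⟩
  have : BorelSpace H := ⟨by
    rw [borel_eq_top_of_discrete]
    exact eq_top_iff.2 fun s _ => MeasurableSet.of_discrete⟩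
  let : ∀ m, MeasurableSpace (W m) := fun m => ⊤
  let P : ∀ m, Measure (W m) := fun m => uniformOn Set.univ
  have hφ : ∀ m, Measurable (φ m) := fun m => measurable_from_top
  have : ∀ m, IsProbabilityMeasure ((P m).map (φ m)) := fun m =>
    Measure.isProbabilityMeasure_map (hφ m).aemeasurable
  let νs : ℕ → ProbabilityMeasure (I → H) := fun m => ⟨(P m).map (φ m), inferInstance⟩
  have hreal : ∀ m (A : Set (I → H)), MeasurableSet A →
      (νs m : Measure (I → H)).real A = uniformProb (φ m ⁻¹' A) := fun m A hA => by
    change ((P m).map (φ m)).real A = _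
    rw [map_measureReal_apply (hφ m) hA]
    exact uniformOn_univ_real _
  have hT : IsTightMeasureSet
      {((μ : ProbabilityMeasure (I → H)) : Measure (I → H)) | μ ∈ Set.range νs} := by
    rw [isTightMeasureSet_iff_exists_isCompact_measure_compl_le]
    intro ε hε
    -- Coordinate `i` may leave its finite set with probability `δ i`. The product of the finite
    -- sets is compact, and the losses sum to less than `ε`.
    obtain ⟨δ, hδ, hsum⟩ := ENNReal.exists_pos_sum_of_countable hε.ne' I
    choose F hF hFP using fun i =>
      exists_finite_forall_uniformProb_le (fun m y => φ m y i) (ε := δ i) (hδ i).le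
        (htight i (δ i) (by exact_mod_cast hδ i))
    refine ⟨Set.univ.pi F, isCompact_univ_pi fun i => (hF i).isCompact, ?_⟩
    rintro _ ⟨_, ⟨m, rfl⟩, rfl⟩
    have hc : (Set.univ.pi F)ᶜ = ⋃ i, {ψ : I → H | ψ i ∉ F i} := by
      ext ψ; simp [Set.mem_pi]
    rw [hc]
    refine (measure_iUnion_le _).trans (le_trans (ENNReal.tsum_le_tsum fun i => ?_) hsum.le)
    have hm : MeasurableSet {ψ : I → H | ψ i ∉ F i} :=
      measurable_pi_apply (X := fun _ : I => H) i
        (MeasurableSet.of_discrete (s := (F i)ᶜ))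
    have := hFP i m
    rw [← ENNReal.ofReal_coe_nnreal, ← ofReal_measureReal, hreal m _ hm]
    exact ENNReal.ofReal_le_ofReal this
  let f : Ultrafilter ℕ := Ultrafilter.of atTop
  obtain ⟨ν, -, hν⟩ := (isCompact_closure_of_isTightMeasureSet hT).ultrafilter_le_nhds
    (f.map νs) (by
      rw [le_principal_iff]
      exact mem_of_superset (range_mem_map (m := νs) (f := (f : Filter ℕ))) subset_closure)
  have hν' : Tendsto νs f (𝓝 ν) := hν
  refine ⟨f, ν, Ultrafilter.of_le _, inferInstance, fun s A => ?_⟩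
  have hm : MeasurableSet (cylinder (α := fun _ => H) s A) := MeasurableSet.cylinder s MeasurableSet.of_discrete
  -- As `H` is discrete, cylinders have empty frontier, so weak convergence gives convergence of
  -- their measures.
  have hclopen : IsClopen (cylinder (α := fun _ => H) s A) :=
    (isClopen_discrete A).preimage (Finset.continuous_restrict s)
  have key := ProbabilityMeasure.tendsto_measure_of_null_frontier_of_tendsto' hν'
    (E := cylinder (α := fun _ => H) s A) (by rw [hclopen.frontier_eq, measure_empty])
  refine ((ENNReal.tendsto_toReal (measure_ne_top _ _)).comp key).congr fun m => ?_
  exact hreal m _ hm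

end Limit

/-! ### The coupling of an invariant random injection -/

/-- The space of injective maps from `G` to `H`. -/
def InjectiveMap (G : Type u) (H : Type v) : Type (max u v) :=
  {ψ : G → H // Function.Injective ψ}

namespace InjectiveMap

variable {G : Type u} {H : Type v}

/-- The underlying map. -/
def toMap (ψ : InjectiveMap G H) : G → H := ψ.1

instance : CoeFun (InjectiveMap G H) (fun _ => G → H) := ⟨toMap⟩

theorem injective (ψ : InjectiveMap G H) : Function.Injective ψ := ψ.2

@[ext]
theorem ext {ψ φ : InjectiveMap G H} (h : ∀ k, ψ k = φ k) : ψ = φ := Subtype.ext (funext h)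

instance [MeasurableSpace H] : MeasurableSpace (InjectiveMap G H) :=
  inferInstanceAs (MeasurableSpace {ψ : G → H // Function.Injective ψ})

theorem measurable_toMap [MeasurableSpace H] :
    Measurable (toMap : InjectiveMap G H → G → H) :=
  measurable_subtype_coe

theorem measurable_eval [MeasurableSpace H] (k : G) :
    Measurable (fun ψ : InjectiveMap G H => ψ k) :=
  (measurable_pi_apply k).comp measurable_toMap

theorem measurable_of_eval [MeasurableSpace H] {α : Type*} [MeasurableSpace α]
    {f : α → InjectiveMap G H} (h : ∀ k, Measurable fun a => f a k) : Measurable f :=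
  Measurable.subtype_mk (measurable_pi_lambda _ h)

theorem measurableSet_injective [Countable G] [Countable H] [MeasurableSpace H]
    [DiscreteMeasurableSpace H] :
    MeasurableSet {ψ : G → H | Function.Injective ψ} := by
  have : {ψ : G → H | Function.Injective ψ} =
      ⋂ (k : G) (k' : G) (_ : k ≠ k'), {ψ : G → H | ψ k ≠ ψ k'} := by
    ext ψ
    simp only [Set.mem_ofPred_eq, Set.mem_iInter]
    exact ⟨fun h k k' hk => h.ne hk, fun h k k' hk => by_contra fun hne => h k k' hne hk⟩
  rw [this]
  refine MeasurableSet.iInter fun k => MeasurableSet.iInter fun k' => MeasurableSet.iInter fun _ =>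
    (measurableSet_eq_fun (measurable_pi_apply k) (measurable_pi_apply k')).compl

instance [Countable G] [Countable H] [MeasurableSpace H] [DiscreteMeasurableSpace H] :
    StandardBorelSpace (InjectiveMap G H) :=
  measurableSet_injective.standardBorel

theorem measurableEmbedding_toMap [Countable G] [Countable H] [MeasurableSpace H]
    [DiscreteMeasurableSpace H] :
    MeasurableEmbedding (toMap : InjectiveMap G H → G → H) :=
  MeasurableEmbedding.subtype_coe measurableSet_injective

/-- `G` acts by translating the variable. -/
instance instMulActionSource [Group G] : MulAction G (InjectiveMap G H) where
  smul g ψ := ⟨fun k => ψ (g⁻¹ * k), ψ.injective.comp (mul_right_injective g⁻¹)⟩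
  one_smul ψ := ext fun k => congrArg ψ.toMap (by simp)
  mul_smul g g' ψ := ext fun k => congrArg ψ.toMap (by simp [mul_assoc])

/-- `H` acts by translating the values. -/
instance instMulActionTarget [Group H] : MulAction H (InjectiveMap G H) where
  smul h ψ := ⟨fun k => h * ψ k, (mul_right_injective h).comp ψ.injective⟩
  one_smul _ := ext fun _ => one_mul _
  mul_smul _ _ _ := ext fun _ => mul_assoc _ _ _

theorem eq_one_of_source_smul_eq [Group G] (g : G) (ψ : InjectiveMap G H) (h : g • ψ = ψ) :
    g = 1 := by
  have h₁ : ψ (g⁻¹ * 1) = ψ 1 := congrArg (fun φ : InjectiveMap G H => φ 1) h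
  simpa using ψ.injective h₁

theorem measurable_source_smul [Group G] [MeasurableSpace H] (g : G) :
    Measurable (fun ψ : InjectiveMap G H => g • ψ) :=
  measurable_of_eval fun k => measurable_eval (g⁻¹ * k)

theorem measurable_target_smul [Group H] [MeasurableSpace H]
    [DiscreteMeasurableSpace H] (h : H) : Measurable (fun ψ : InjectiveMap G H => h • ψ) :=
  measurable_of_eval fun k => (measurable_eval k).const_mul h

variable (G H) in
/-- The normalized injective maps. -/
def normalized [Group G] [Group H] : Set (InjectiveMap G H) := {ψ | ψ 1 = 1}

theorem measurableSet_normalized [Group G] [Group H] [Countable H] [MeasurableSpace H]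
    [DiscreteMeasurableSpace H] : MeasurableSet (normalized G H) :=
  measurable_eval 1 (MeasurableSet.singleton (1 : H))

theorem target_smul_mem_normalized [Group G] [Group H] {h : H} {ψ : InjectiveMap G H} :
    h • ψ ∈ normalized G H ↔ h = (ψ 1)⁻¹ :=
  mul_eq_one_iff_eq_inv

/-- The injective maps whose value at `1` comes first in a given enumeration of `H`. -/
def leastAtOne [Group G] (e : H → ℕ) : Set (InjectiveMap G H) := {ψ | ∀ k, e (ψ 1) ≤ e (ψ k)}

theorem measurableSet_leastAtOne [Group G] [Countable G] [MeasurableSpace H]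
    [DiscreteMeasurableSpace H] (e : H → ℕ) :
    MeasurableSet (leastAtOne e : Set (InjectiveMap G H)) := by
  have : (leastAtOne e : Set (InjectiveMap G H)) = ⋂ k : G, {ψ | e (ψ 1) ≤ e (ψ k)} := by
    ext; simp [leastAtOne]
  rw [this]
  exact MeasurableSet.iInter fun k => measurableSet_le
    ((Measurable.of_discrete (f := e)).comp (measurable_eval 1))
    ((Measurable.of_discrete (f := e)).comp (measurable_eval k))

variable [Group G] [Group H]

instance : SMulCommClass G H (InjectiveMap G H) := ⟨fun _ _ _ => rfl⟩

theorem eq_one_of_target_smul_eq (h : H) (ψ : InjectiveMap G H) (hψ : h • ψ = ψ) : h = 1 := by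
  have : h * ψ 1 = ψ 1 := congrArg (fun φ : InjectiveMap G H => φ 1) hψ
  simpa using this

/-! ### The coupling measure, its invariance and its fundamental domains -/

section Measure

variable [Countable G] [Countable H] [MeasurableSpace H] [DiscreteMeasurableSpace H]

/-- The sum of all `H`-translates of a measure. -/
noncomputable def couplingMeasure (ν : Measure (InjectiveMap G H)) :
    Measure (InjectiveMap G H) :=
  Measure.sum fun h : H => ν.map (h • ·)

theorem lintegral_couplingMeasure (ν : Measure (InjectiveMap G H))
    {f : InjectiveMap G H → ENNReal} (hf : Measurable f) :
    ∫⁻ ψ, f ψ ∂couplingMeasure ν = ∫⁻ φ, ∑' h : H, f (h • φ) ∂ν := by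
  rw [couplingMeasure, lintegral_sum_measure,
    lintegral_tsum (f := fun (h : H) φ => f (h • φ))
      fun h => (hf.comp (measurable_target_smul h)).aemeasurable]
  exact tsum_congr fun h => lintegral_map hf (measurable_target_smul h)

theorem measurePreserving_target_smul (ν : Measure (InjectiveMap G H)) (h : H) :
    MeasurePreserving (fun ψ : InjectiveMap G H => h • ψ) (couplingMeasure ν)
      (couplingMeasure ν) := by
  refine ⟨measurable_target_smul h, Measure.ext_of_lintegral _ fun f hf => ?_⟩
  rw [lintegral_map hf (measurable_target_smul h), lintegral_couplingMeasure ν hf,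
    lintegral_couplingMeasure ν (f := fun ψ => f (h • ψ))
      (hf.comp (measurable_target_smul h))]
  refine lintegral_congr fun φ => ?_
  simp only [← mul_smul]
  exact (Equiv.mulLeft h).tsum_eq fun h' => f (h' • φ)

/-- The coupling measure is `G`-invariant if the measure is invariant under translating the
variable and renormalizing. -/
theorem measurePreserving_source_smul {ν : Measure (InjectiveMap G H)} {g : G}
    (hν : MeasurePreserving (fun φ : InjectiveMap G H => (φ g⁻¹)⁻¹ • g • φ) ν ν) :
    MeasurePreserving (fun ψ : InjectiveMap G H => g • ψ) (couplingMeasure ν)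
      (couplingMeasure ν) := by
  refine ⟨measurable_source_smul g, Measure.ext_of_lintegral _ fun f hf => ?_⟩
  rw [lintegral_map hf (measurable_source_smul g), lintegral_couplingMeasure ν hf,
    lintegral_couplingMeasure ν (f := fun ψ => f (g • ψ))
      (hf.comp (measurable_source_smul g))]
  have hF : Measurable fun φ : InjectiveMap G H => ∑' h : H, f (h • φ) :=
    Measurable.tsum fun h => hf.comp (measurable_target_smul h)
  rw [← hν.lintegral_comp hF]
  refine lintegral_congr fun φ => ?_
  -- The sum over all `H`-translates does not see the renormalizing factor, which is absorbed by
  -- reindexing.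
  rw [← (Equiv.mulRight (φ g⁻¹)⁻¹).tsum_eq fun h' : H => f (g • h' • φ)]
  refine tsum_congr fun h => ?_
  rw [Equiv.coe_mulRight, mul_smul, smul_comm g h, smul_comm g (φ g⁻¹)⁻¹]

theorem isFundamentalDomain_normalized (μ : Measure (InjectiveMap G H)) :
    IsFundamentalDomain H (normalized G H) μ :=
  IsFundamentalDomain.mk' measurableSet_normalized.nullMeasurableSet fun ψ =>
    ⟨(ψ 1)⁻¹, target_smul_mem_normalized.2 rfl, fun _ => target_smul_mem_normalized.1⟩

/-- Along an injective `ψ` the enumeration `e` has its minimum at exactly one point `k₀`, and `g •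
ψ` takes the value `ψ g⁻¹` at `1`; so `k₀⁻¹` is the only translation that works. -/
theorem isFundamentalDomain_leastAtOne {e : H → ℕ} (he : Function.Injective e)
    (μ : Measure (InjectiveMap G H)) : IsFundamentalDomain G (leastAtOne e) μ := by
  refine IsFundamentalDomain.mk' (measurableSet_leastAtOne e).nullMeasurableSet fun ψ => ?_
  have hmem (g : G) : g • ψ ∈ leastAtOne e ↔ ∀ k, e (ψ g⁻¹) ≤ e (ψ k) := by
    change (∀ k, e (ψ (g⁻¹ * 1)) ≤ e (ψ (g⁻¹ * k))) ↔ _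
    rw [mul_one]
    exact ⟨fun h k => by simpa using h (g * k), fun h k => h _⟩
  let k₀ := Function.argmin fun k => e (ψ k)
  have hk₀ (k : G) : e (ψ k₀) ≤ e (ψ k) := Function.argmin_le (fun k => e (ψ k)) k
  refine ⟨k₀⁻¹, (hmem _).2 (by simpa using hk₀), fun g hg => ?_⟩
  have := ψ.injective (he (((hmem g).1 hg k₀).antisymm (hk₀ g⁻¹)))
  rw [← this, inv_inv]

/-- Each `H`-orbit meets the normalized maps exactly once, so the function integrated against `ν` is
constantly one. -/
theorem couplingMeasure_normalized {ν : Measure (InjectiveMap G H)} [IsProbabilityMeasure ν] :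
    couplingMeasure ν (normalized G H) = 1 := by
  classical
  rw [← lintegral_indicator_one measurableSet_normalized, lintegral_couplingMeasure ν
    (measurable_one.indicator measurableSet_normalized)]
  have : ∀ φ : InjectiveMap G H,
      ∑' h : H, (normalized G H).indicator (1 : InjectiveMap G H → ENNReal) (h • φ) = 1 := by
    intro φ
    rw [tsum_eq_single (φ 1)⁻¹ fun h hh =>
      Set.indicator_of_notMem (fun hmem => hh (target_smul_mem_normalized.1 hmem)) _]
    exact Set.indicator_of_mem (target_smul_mem_normalized.2 rfl) _
  simp [this]

/-- The `H`-translates of the normalized maps are countably many sets of measure one that cover the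
space. -/
theorem sigmaFinite_couplingMeasure (ν : Measure (InjectiveMap G H)) [IsProbabilityMeasure ν] :
    SigmaFinite (couplingMeasure ν) := by
  refine Measure.sigmaFinite_of_countable (S := Set.range fun h : H =>
    (fun ψ => h • ψ) ⁻¹' normalized G H) (Set.countable_range _) ?_ ?_
  · rintro _ ⟨h, rfl⟩
    rw [(measurePreserving_target_smul ν h).measure_preimage
      measurableSet_normalized.nullMeasurableSet, couplingMeasure_normalized]
    exact ENNReal.one_lt_top
  · exact Set.eq_univ_of_forall fun ψ => ⟨_, ⟨(ψ 1)⁻¹, rfl⟩, target_smul_mem_normalized.2 rfl⟩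

/-- The coupling of an invariant random injection, as in `measurePreserving_source_smul`. -/
theorem exists_injective_coupling {ν : Measure (InjectiveMap G H)} [IsProbabilityMeasure ν]
    (hν : ∀ g : G, MeasurePreserving (fun φ : InjectiveMap G H => (φ g⁻¹)⁻¹ • g • φ) ν ν) :
    ∃ c : MeasureSubgroupCoupling G H, c.IsInjective := by
  obtain ⟨e, he⟩ := exists_injective_nat H
  have := sigmaFinite_couplingMeasure ν
  refine ⟨{ Ω := InjectiveMap G H
            μ := couplingMeasure ν
            measurePreservingG := fun g => measurePreserving_source_smul (hν g)
            measurePreservingH := measurePreserving_target_smul ν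
            freeG := eq_one_of_source_smul_eq
            freeH := eq_one_of_target_smul_eq
            XG := leastAtOne e
            XH := normalized G H
            measurableSet_XG := measurableSet_leastAtOne e
            measurableSet_XH := measurableSet_normalized
            fundamentalDomainG := isFundamentalDomain_leastAtOne he _
            fundamentalDomainH := isFundamentalDomain_normalized _
            measure_XH := couplingMeasure_normalized },
    -- The value of `g • ψ` at `1` is `ψ g⁻¹`, and its inverse is the factor that normalizes `g •
    -- ψ`.
    fun g (ψ : InjectiveMap G H) => (ψ g⁻¹)⁻¹, ⟨fun g h => ?_, ?_⟩, ?_⟩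
  · exact (measurable_eval g⁻¹).inv (MeasurableSet.singleton h)
  · refine Eventually.of_forall fun (ψ : InjectiveMap G H) g h => ?_
    refine target_smul_mem_normalized.trans ?_
    change h = (ψ (g⁻¹ * 1))⁻¹ ↔ _
    rw [mul_one]
  · exact Eventually.of_forall fun (ψ : InjectiveMap G H) g g' h =>
      inv_injective (ψ.injective (inv_injective h))

/-- A law on all maps that is concentrated on injective maps and invariant under translating the
variable and renormalizing gives rise to an injective coupling. -/
theorem exists_injective_coupling_of_law {ν : Measure (G → H)} [IsProbabilityMeasure ν]
    (hinj : ∀ᵐ φ ∂ν, Function.Injective φ)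
    (hν : ∀ g : G, MeasurePreserving (fun (φ : G → H) k => (φ g)⁻¹ * φ (g * k)) ν ν) :
    ∃ c : MeasureSubgroupCoupling G H, c.IsInjective := by
  have htoMap := measurableEmbedding_toMap (G := G) (H := H)
  let ν' : Measure (InjectiveMap G H) := ν.comap toMap
  have hmap : ν'.map toMap = ν := by
    rw [htoMap.map_comap]
    refine Measure.restrict_eq_self_of_ae_mem ?_
    filter_upwards [hinj] with φ hφ using ⟨⟨φ, hφ⟩, rfl⟩
  have : IsProbabilityMeasure ν' :=
    ⟨by rw [← Set.preimage_univ (f := (toMap : InjectiveMap G H → G → H)),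
      ← Measure.map_apply htoMap.measurable .univ, hmap, measure_univ]⟩
  refine exists_injective_coupling (ν := ν') fun g => ?_
  have hmeas : Measurable fun φ : InjectiveMap G H => (φ g⁻¹)⁻¹ • g • φ :=
    measurable_of_eval fun k =>
      (measurable_eval g⁻¹).inv.mul (measurable_eval (g⁻¹ * k))
  refine ⟨hmeas, Measure.ext fun A hA => ?_⟩
  obtain ⟨B, hB, rfl⟩ := hA
  change ν'.map _ (toMap ⁻¹' B) = ν' (toMap ⁻¹' B)
  rw [← Measure.map_apply htoMap.measurable hB, Measure.map_map htoMap.measurable hmeas]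
  have hcomp : (toMap ∘ fun φ : InjectiveMap G H => (φ g⁻¹)⁻¹ • g • φ) =
      (fun (φ : G → H) k => (φ g⁻¹)⁻¹ * φ (g⁻¹ * k)) ∘ toMap := rfl
  rw [hcomp, ← Measure.map_map (hν g⁻¹).measurable htoMap.measurable, hmap, (hν g⁻¹).map_eq,
    ← Measure.map_apply htoMap.measurable hB, hmap]

end Measure

end InjectiveMap

/-! ### From approximate actions on finite sets to a coupling -/

section Model

variable {G : Type u} {H : Type v} [Group G] [Group H]

theorem tendsto_uniformProb_biUnion {ι : Type*} {W : ℕ → Type*} (l : Filter ℕ) (s : Finset ι)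
    (B : ∀ m, ι → Set (W m))
    (h : ∀ i ∈ s, Tendsto (fun m => uniformProb (B m i)) l (𝓝 0)) :
    Tendsto (fun m => uniformProb (⋃ i ∈ s, B m i)) l (𝓝 0) := by
  classical
  induction s using Finset.induction_on with
  | empty => simpa [uniformProb] using tendsto_const_nhds
  | insert i s _ ih =>
    simp only [Finset.set_biUnion_insert]
    have h₁ := h i (Finset.mem_insert_self i s)
    have h₂ := ih fun j hj => h j (Finset.mem_insert_of_mem hj)
    exact squeeze_zero (fun m => uniformProb_nonneg _) (fun m => uniformProb_union_le _ _)
      (by simpa using h₁.add h₂)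

/-- A vertex `y` of an approximate right action `a` of `G` on `W` and a map `u : W → H` give the
map `g ↦ (u y)⁻¹ * u (y · g)`. -/
def localMap {W : Type*} (a : G → W → W) (u : W → H) (y : W) (g : G) : H :=
  (u y)⁻¹ * u (a g y)

/-- Injections into `H` of finite sets that carry approximate free right actions of `G` produce an
injective coupling, if the displacements of the images are tight. -/
theorem exists_injective_coupling_of_approximate_actions [Countable G] [Countable H]
    {W : ℕ → Type w} [∀ m, Finite (W m)] [∀ m, Nonempty (W m)] (a : ∀ m, G → W m → W m)
    (u : ∀ m, W m → H) (hu : ∀ m, Function.Injective (u m))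
    (hone : Tendsto (fun m => uniformProb {y | a m 1 y ≠ y}) atTop (𝓝 0))
    (hmul : ∀ g k : G,
      Tendsto (fun m => uniformProb {y | a m (g * k) y ≠ a m k (a m g y)}) atTop (𝓝 0))
    (hfree : ∀ g k : G, g ≠ k →
      Tendsto (fun m => uniformProb {y | a m g y = a m k y}) atTop (𝓝 0))
    (htight : ∀ (g : G) (ε : ℝ), 0 < ε → ∃ F : Set H, F.Finite ∧
      ∀ᶠ m in atTop, uniformProb {y | localMap (a m) (u m) y g ∉ F} ≤ ε) :
    ∃ c : MeasureSubgroupCoupling G H, c.IsInjective := by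
  classical
  let : MeasurableSpace H := ⊤
  have : DiscreteMeasurableSpace H := ⟨fun _ => trivial⟩
  obtain ⟨f, ν, hf, _, hν⟩ := exists_limit_law (fun m => localMap (a m) (u m)) htight
  refine InjectiveMap.exists_injective_coupling_of_law (ν := ν) ?_ fun g => ?_
  · -- injectivity
    have key (g k : G) (hgk : g ≠ k) : ∀ᵐ φ ∂ν, φ g ≠ φ k := by
      have h := hν {g, k} {ψ | ψ ⟨g, by simp⟩ = ψ ⟨k, by simp⟩}
      have h' : Tendsto (fun m => uniformProb (localMap (a m) (u m) ⁻¹' cylinder (α := fun _ => H)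
          {g, k} {ψ | ψ ⟨g, by simp⟩ = ψ ⟨k, by simp⟩})) f (𝓝 0) := by
        refine squeeze_zero (fun m => uniformProb_nonneg _) (fun m => uniformProb_mono ?_)
          ((hfree g k hgk).mono_left hf)
        intro y hy
        -- Equal displacements force equal images under `u m`, hence a failure of freeness at `y`.
        exact hu m (mul_left_cancel (show localMap (a m) (u m) y g = localMap (a m) (u m) y k
          from hy))
      have h0 := tendsto_nhds_unique h h'
      rw [measureReal_eq_zero_iff] at h0
      exact measure_eq_zero_iff_ae_notMem.1 h0
    have := ae_all_iff.2 fun g : G => ae_all_iff.2 fun k : G => ae_all_iff.2 (key g k)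
    filter_upwards [this] with φ hφ g k h
    exact by_contra fun hgk => hφ g k hgk h
  · -- invariance
    set T : (G → H) → (G → H) := fun φ k => (φ g)⁻¹ * φ (g * k) with hTdef
    have hT : Measurable T := measurable_pi_lambda _ fun k =>
      (measurable_pi_apply g).inv.mul (measurable_pi_apply (g * k))
    have : IsProbabilityMeasure (ν.map T) := Measure.isProbabilityMeasure_map hT.aemeasurable
    have hle (s : Finset G) (A : Set (s → H)) :
        (ν.map T).real (cylinder (α := fun _ => H) s A) ≤
          ν.real (cylinder (α := fun _ => H) s A) := by
      rw [map_measureReal_apply hT (MeasurableSet.cylinder s MeasurableSet.of_discrete)]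
      -- The preimage under `T` of a cylinder over `s` depends only on the coordinates `g` and `g *
      -- k` with `k ∈ s`.
      let s' : Finset G := insert g (s.image (g * ·))
      have hs' (k : s) : g * (k : G) ∈ s' :=
        Finset.mem_insert_of_mem (Finset.mem_image_of_mem _ k.2)
      let A' : Set (s' → H) :=
        {ψ | (fun k : s => (ψ ⟨g, Finset.mem_insert_self _ _⟩)⁻¹ * ψ ⟨g * k, hs' k⟩) ∈ A}
      have hpre : T ⁻¹' cylinder (α := fun _ => H) s A = cylinder (α := fun _ => H) s' A' := rfl
      rw [hpre]
      let bad (m : ℕ) : Set (W m) := {y | a m 1 y ≠ y} ∪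
        ({y | a m (g * g⁻¹) y ≠ a m g⁻¹ (a m g y)} ∪
          ⋃ k ∈ s, {y | a m (g * k) y ≠ a m k (a m g y)})
      have hbad : Tendsto (fun m => uniformProb (bad m)) f (𝓝 0) := by
        have h₁ := hone.add ((hmul g g⁻¹).add (tendsto_uniformProb_biUnion atTop s
          (fun m k => {y | a m (g * k) y ≠ a m k (a m g y)}) fun k _ => hmul g k))
        simp only [add_zero] at h₁
        exact squeeze_zero (fun m => uniformProb_nonneg _)
          (fun m => (uniformProb_union_le _ _).trans
            (add_le_add_right (uniformProb_union_le _ _) _)) (h₁.mono_left hf)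
      have hlim := hbad.add (hν s A)
      rw [zero_add] at hlim
      refine le_of_tendsto_of_tendsto' (hν s' A') hlim fun m => ?_
      have hinj : Set.InjOn (a m g) (bad m)ᶜ := by
        -- Off the bad set, translation by `g⁻¹` undoes translation by `g`, through the product `g *
        -- g⁻¹` and the identity.
        have hinv (y : W m) (hy : y ∉ bad m) : a m g⁻¹ (a m g y) = y := by
          simp only [bad, Set.mem_union, not_or, Set.mem_ofPred_eq, not_not] at hy
          rw [← hy.2.1, mul_inv_cancel, hy.1]
        intro y hy z hz h
        rw [← hinv y hy, ← hinv z hz, h]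
      refine (uniformProb_mono (B := bad m ∪ ((bad m)ᶜ ∩ a m g ⁻¹'
        (localMap (a m) (u m) ⁻¹' cylinder (α := fun _ => H) s A))) fun y hy => ?_).trans
        ((uniformProb_union_le _ _).trans (add_le_add_right
          (uniformProb_inter_preimage_le hinj _) _))
      by_cases hyb : y ∈ bad m
      · exact Or.inl hyb
      · refine Or.inr ⟨hyb, ?_⟩
        change (fun k : s => (localMap (a m) (u m) y g)⁻¹ * localMap (a m) (u m) y (g * k)) ∈ A
          at hy
        -- Off the bad set the renormalized translate of the local map at `y` is the local map at `y
        -- · g`: the factors `u m y` cancel.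
        change (fun k : s => localMap (a m) (u m) (a m g y) k) ∈ A
        convert hy using 2 with k
        simp only [bad, Set.mem_union, not_or, Set.mem_ofPred_eq, Set.mem_iUnion, not_exists,
          not_not] at hyb
        simp [localMap, hyb.2.2 k k.2, mul_assoc]
    refine ⟨hT, ext_of_generate_finite (measurableCylinders fun _ : G => H)
      generateFrom_measurableCylinders.symm isPiSystem_measurableCylinders ?_ (by simp)⟩
    intro t ht
    obtain ⟨s, A, -, rfl⟩ := (mem_measurableCylinders t).1 ht
    have hm := MeasurableSet.cylinder (α := fun _ : G => H) s
      (MeasurableSet.of_discrete (s := A))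
    refine (measureReal_eq_measureReal_iff).1 ((hle s A).antisymm ?_)
    -- For probability measures, the inequality on the complementary cylinder is the reverse
    -- inequality.
    have hc := hle s Aᶜ
    rw [← compl_cylinder, probReal_compl_eq_one_sub hm, probReal_compl_eq_one_sub hm] at hc
    linarith

end Model

/-! ### Sofic approximations and statistically Lipschitz injections -/

section Sofic

open LabeledDigraph

variable {G : Type u} {H : Type v} [Group G] [Group H] {SG : Finset G} {SH : Finset H}
  {V : ℕ → Type w} {𝒢 : ∀ n, LabeledDigraph SG (V n)}

/-- The vertices whose `r`-ball does not look like that of the Cayley graph. -/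
def LabeledDigraph.badVertices {V : Type*} (Γ : LabeledDigraph SG V) (r : ℕ) : Set V :=
  {x | ¬ Γ.BallIso (cayleyGraph SG) r x (1 : G)}

/-- On an empty vertex set `uniformProb` is `0`, which is incompatible with a limit of one. -/
theorem IsSoficApproximation.eventually_nonempty (h : IsSoficApproximation SG 𝒢) :
    ∀ᶠ n in atTop, Nonempty (V n) := by
  filter_upwards [(h 0).eventually_ne one_ne_zero] with n hn
  by_contra hV
  have := not_nonempty_iff.1 hV
  simp [uniformProb] at hn

variable [∀ n, Finite (V n)]

theorem IsSoficApproximation.tendsto_badVertices (h : IsSoficApproximation SG 𝒢) (r : ℕ) :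
    Tendsto (fun n => uniformProb ((𝒢 n).badVertices r)) atTop (𝓝 0) := by
  have h' := (h r).const_sub 1
  rw [sub_self] at h'
  refine h'.congr' ?_
  filter_upwards [h.eventually_nonempty] with n hn
  exact (uniformProb_compl _).symm

/-- Along the ultrafilter, the displacement `(𝔲 y)⁻¹ * 𝔲 (y · g)` is tight. -/
theorem StatisticallyLipschitz.exists_finite (hSG : Subgroup.closure (SG : Set G) = ⊤)
    {𝒰 : Ultrafilter ℕ} (h𝒰 : (𝒰 : Filter ℕ) ≤ atTop) (h𝒢 : IsSoficApproximation SG 𝒢)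
    {𝔲 : ∀ n, V n → H} (h𝔲 : StatisticallyLipschitz 𝒰 𝒢 (cayleyGraph SH) 𝔲) (g : G) {ε : ℝ}
    (hε : 0 < ε) :
    ∃ F : Set H, F.Finite ∧ ∀ᶠ n in (𝒰 : Filter ℕ),
      uniformProb {y | localMap ((𝒢 n).translate hSG) (𝔲 n) y g ∉ F} ≤ ε := by
  set r := translateLength hSG g
  obtain ⟨ℓ, hℓ, hℓ0⟩ := h𝔲 r
  obtain ⟨C, hC⟩ := (hℓ0.eventually_lt_const (half_pos hε)).exists
  refine ⟨_, finite_inv_mul_of_dist_le SH C, ?_⟩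
  -- Half of `ε` pays for vertices with a large image of the ball, the other half for bad vertices.
  -- At any other `y`, both `𝔲 n y` and the image of its translate lie in a set of diameter below
  -- `C`.
  filter_upwards [(hℓ C).eventually_lt_const hC,
    ((h𝒢.tendsto_badVertices r).mono_left h𝒰).eventually_lt_const (half_pos hε)] with n h₁ h₂
  refine (uniformProb_mono (B := {y : V n | (C : ℕ∞) ≤ (cayleyGraph SH).diam
    (𝔲 n '' (𝒢 n).ball y r)} ∪ (𝒢 n).badVertices r) fun y hy => ?_).trans
    ((uniformProb_union_le _ _).trans (by linarith))
  by_contra hcon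
  simp only [badVertices, Set.mem_union, not_or, Set.mem_ofPred_eq, not_le, not_not] at hcon
  refine hy ⟨𝔲 n y, 𝔲 n ((𝒢 n).translate hSG g y), le_trans ?_ hcon.1.le, rfl⟩
  exact le_iSup₂_of_le _ ⟨y, (𝒢 n).mem_ball_self y r, rfl⟩
    (le_iSup₂_of_le _ ⟨_, hcon.2.translate_mem_ball hSG le_rfl, rfl⟩ le_rfl)

end Sofic

/-- Countably many properties, each of which holds along a filter finer than `atTop`, hold
eventually along a suitable sequence tending to infinity. -/
theorem exists_seq_tendsto_forall_eventually {l : Filter ℕ} [l.NeBot] (hl : l ≤ atTop) {ι : Type*}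
    [Countable ι] {p : ι → ℕ → Prop} (hp : ∀ i, ∀ᶠ n in l, p i n) :
    ∃ n : ℕ → ℕ, Tendsto n atTop atTop ∧ ∀ i, ∀ᶠ m in atTop, p i (n m) := by
  obtain ⟨e, he⟩ := exists_injective_nat ι
  -- The `m`-th index is chosen to satisfy the finitely many properties numbered at most `m`.
  have hev (m : ℕ) : ∀ᶠ n in l, m ≤ n ∧ ∀ i ∈ e ⁻¹' Set.Iic m, p i n :=
    ((eventually_ge_atTop m).filter_mono hl).and
      ((((Set.finite_Iic m).preimage he.injOn).eventually_all).2 fun i _ => hp i)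
  choose n hn hpn using fun m => (hev m).exists
  exact ⟨n, tendsto_atTop_mono hn tendsto_id, fun i =>
    (eventually_ge_atTop (e i)).mono fun m hm => hpn m i hm⟩

theorem theorem1p4 {G : Type u} {H : Type v} [Group G] [Group H]
    (SG : Finset G) (hSG : Subgroup.closure (SG : Set G) = ⊤)
    (SH : Finset H) (hSH : Subgroup.closure (SH : Set H) = ⊤)
    (𝒰 : Ultrafilter ℕ) (h𝒰 : (𝒰 : Filter ℕ) ≤ cofinite)
    {V : ℕ → Type w} [∀ n, Finite (V n)]
    (𝒢 : ∀ n, LabeledDigraph SG (V n)) (h𝒢 : IsSoficApproximation SG 𝒢)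
    (𝔲 : ∀ n, V n → H) (h𝔲_inj : ∀ n, Function.Injective (𝔲 n))
    (h𝔲_lip : StatisticallyLipschitz 𝒰 𝒢 (cayleyGraph SH) 𝔲) :
    ∃ c : MeasureSubgroupCoupling G H, c.IsInjective := by
  have := countable_of_closure_eq_top hSG
  have := countable_of_closure_eq_top hSH
  rw [Nat.cofinite_eq_atTop] at h𝒰
  -- The tolerances `1 / (j + 1)` suffice and leave countably many conditions.
  choose F hF hFU using fun i : G × ℕ =>
    h𝔲_lip.exists_finite hSG h𝒰 h𝒢 i.1 (Nat.one_div_pos_of_nat (α := ℝ) (n := i.2))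
  obtain ⟨N, hN⟩ := eventually_atTop.1 h𝒢.eventually_nonempty
  obtain ⟨n', hn', hFn'⟩ := exists_seq_tendsto_forall_eventually h𝒰 hFU
  obtain ⟨M, hM⟩ := eventually_atTop.1 (hn'.eventually_ge_atTop N)
  -- The shift by `M` makes every vertex set of the sequence nonempty.
  let n : ℕ → ℕ := fun m => n' (m + M)
  have hn : Tendsto n atTop atTop := hn'.comp (tendsto_add_atTop_nat M)
  have hne (m : ℕ) : Nonempty (V (n m)) := hN _ (hM _ (Nat.le_add_left M m))
  -- Each axiom of a free action can fail only at bad vertices of a radius that bounds the words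
  -- involved.
  have hbad (r : ℕ) {B : ∀ m, Set (V (n m))} (hB : ∀ m, B m ⊆ (𝒢 (n m)).badVertices r) :
      Tendsto (fun m => uniformProb (B m)) atTop (𝓝 0) :=
    squeeze_zero (fun m => uniformProb_nonneg _) (fun m => uniformProb_mono (hB m))
      ((h𝒢.tendsto_badVertices r).comp hn)
  refine exists_injective_coupling_of_approximate_actions (W := fun m => V (n m))
    (fun m => (𝒢 (n m)).translate hSG) (fun m => 𝔲 (n m)) (fun m => h𝔲_inj _)
    (hbad (translateLength hSG 1) fun m y hy h => hy (h.translate_one hSG le_rfl))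
    (fun g k => hbad (max (translateLength hSG (g * k))
      (translateLength hSG g + translateLength hSG k)) fun m y hy h =>
        hy (h.translate_mul hSG (le_max_left _ _) (le_max_right _ _)))
    (fun g k hgk => hbad (max (translateLength hSG g) (translateLength hSG k)) fun m y hy h =>
      h.translate_ne hSG (le_max_left _ _) (le_max_right _ _) hgk hy)
    fun g ε hε => ?_
  obtain ⟨j, hj⟩ := exists_nat_one_div_lt hε
  refine ⟨F (g, j), hF _, ?_⟩
  filter_upwards [(tendsto_add_atTop_nat M).eventually (hFn' (g, j))] with m hm
  exact hm.trans hj.le
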